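/- Let $n\in\mathbb{N}$, $y,a\in\mathbb{R}^n$, $b\in\mathbb{R}$, let $e\in\mathbb{R}^n$ be the all-ones vector and $\Delta=\{x\in\mathbb{R}^n : e^\top x=1,\ x\ge 0\}$, and let $\Pi_\Delta$ be the Euclidean projection onto $\Delta$. Assume that $\mathcal{C}=\{x\in\Delta : a^\top x\le b\}$ is non-empty and that $a\neq b\,e$. For $\sigma\in\mathbb{R}$ put $$h(\sigma)=\min_{x\in\Delta}\Big\{\tfrac12\|x-y\|^2+\sigma(a^\top x-b)\Big\},\qquad \psi(\sigma)=a^\top\Pi_\Delta(y-\sigma a)-b ,$$ and let $\partial\psi(\sigma)$ be Clarke's generalized differential, i.e. the convex hull of all limits $\lim_k\psi'(\sigma_k)$ along sequences $\sigma_k\to\sigma$ of points at which $\psi$ is differentiable. Let $\hat\mu\in(0,1/2)$, $\hat\delta,\hat\tau_1\in(0,1)$, $\hat\tau_2\in(0,1]$ and $\sigma^0\ge 0$. Suppose that $\psi(0)>0$ and that $\{\sigma^j\}_{j\ge0}$ is an infinite sequence generated by the semismooth Newton method with Armijo line search, that is, for every $j\ge 0$: $\psi(\sigma^j)\ne0$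 (the method does not stop); some $\upsilon_j\in\partial\psi(\sigma^j)$ is chosen and $$\Delta\sigma^j=-\frac{\psi(\sigma^j)}{\upsilon_j-\bar\epsilon_j},\qquad \bar\epsilon_j=\hat\tau_2\min\{\hat\tau_1,|\psi(\sigma^j)|\};$$ $m_j$ is the smallest non-negative integer $m$ with $h(\sigma^j+\hat\delta^m\Delta\sigma^j)\ge h(\sigma^j)+\hat\mu\hat\delta^m\psi(\sigma^j)\Delta\sigma^j$; and $\sigma^{j+1}=\sigma^j+\hat\delta^{m_j}\Delta\sigma^j$. Then $\{\sigma^j\}$ is bounded, and every accumulation point $\sigma^*$ of $\{\sigma^j\}$ is an optimal solution of the dual problem $\max_{\sigma\ge0}h(\sigma)$. Moreover, $\sigma^j\to\sigma^*$ and the rate of convergence is quadratic: $|\sigma^{j+1}-\sigma^*|=O(|\sigma^j-\sigma^*|^2)$ as $j\to\infty$. -/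

import Mathlib

open Set Filter Topology Asymptotics

/-- The standard simplex `{x ∈ ℝⁿ | eᵀx = 1, x ≥ 0}`, in Euclidean space. -/
def unitSimplex (n : ℕ) : Set (EuclideanSpace ℝ (Fin n)) :=
  {x | (∀ i, 0 ≤ x i) ∧ ∑ i, x i = 1}

/-- `x` minimizes `½‖w - z‖²` over `w ∈ S`, i.e. `x` is a metric projection of `z` onto `S`. -/
def IsProjOnto {n : ℕ} (S : Set (EuclideanSpace ℝ (Fin n))) (z x : EuclideanSpace ℝ (Fin n)) :
    Prop :=
  x ∈ S ∧ IsMinOn (fun w => (1 / 2 : ℝ) * ‖w - z‖ ^ 2) S x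

/-- The metric projection onto the simplex (see `simplexProj_spec`, `simplexProj_unique`). -/
noncomputable def simplexProj {n : ℕ} (z : EuclideanSpace ℝ (Fin n)) :
    EuclideanSpace ℝ (Fin n) :=
  Classical.epsilon (IsProjOnto (unitSimplex n) z)

/-- The feasible set `C = {x ∈ Δ | aᵀx ≤ b}`. -/
def feasibleSet {n : ℕ} (a : EuclideanSpace ℝ (Fin n)) (b : ℝ) :
    Set (EuclideanSpace ℝ (Fin n)) :=
  {x | inner ℝ a x ≤ b ∧ x ∈ unitSimplex n}

/-- The Lagrangian `½‖x - y‖² + σ(aᵀx - b)` (on the simplex). -/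
noncomputable def lagrangian {n : ℕ} (y a : EuclideanSpace ℝ (Fin n)) (b : ℝ)
    (x : EuclideanSpace ℝ (Fin n)) (σ : ℝ) : ℝ :=
  (1 / 2 : ℝ) * ‖x - y‖ ^ 2 + σ * (inner ℝ a x - b)

/-- The dual function `h(σ) = min_{x ∈ Δ} L(x; σ)`; for `n ≥ 1` the minimum is attained. -/
noncomputable def dualFun {n : ℕ} (y a : EuclideanSpace ℝ (Fin n)) (b σ : ℝ) : ℝ :=
  sInf ((fun x => lagrangian y a b x σ) '' unitSimplex n)

/-- `ψ(σ) = aᵀ Π_Δ(y - σ a) - b`. -/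
noncomputable def psi {n : ℕ} (y a : EuclideanSpace ℝ (Fin n)) (b σ : ℝ) : ℝ :=
  inner ℝ a (simplexProj (y - σ • a)) - b

/-- Optimal solutions of the dual problem `max_{σ ≥ 0} h(σ)`. -/
def IsDualSolution {n : ℕ} (y a : EuclideanSpace ℝ (Fin n)) (b s : ℝ) : Prop :=
  s ∈ Ici (0 : ℝ) ∧ IsMaxOn (dualFun y a b) (Ici 0) s

/-- Clarke's generalized differential of a function of one real variable: the convex hull of all
limits of derivatives at points of differentiability tending to `s`. -/
def clarkeDiff (f : ℝ → ℝ) (s : ℝ) : Set ℝ :=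
  convexHull ℝ {v | ∃ u : ℕ → ℝ, Tendsto u atTop (𝓝 s) ∧ (∀ k, DifferentiableAt ℝ f (u k)) ∧
    Tendsto (fun k => deriv f (u k)) atTop (𝓝 v)}

/-- The regularized Newton direction `-ψ(s) / (v - ε̄)` with `ε̄ = τ₂ min{τ₁, |ψ(s)|}`. -/
noncomputable def newtonDir {n : ℕ} (y a : EuclideanSpace ℝ (Fin n)) (b τ₁ τ₂ s v : ℝ) : ℝ :=
  -psi y a b s / (v - τ₂ * min τ₁ |psi y a b s|)

/-- `σ` is an infinite sequence of iterates of the semismooth Newton method with Armijo line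
search: the initial test `ψ(0) ≤ 0` fails, the stopping test `ψ(σʲ) = 0` never succeeds, `v j` is
the chosen element of the generalized differential at `σʲ`, and `m j` is the exponent found by the
line search. -/
structure IsSSNSequence {n : ℕ} (y a : EuclideanSpace ℝ (Fin n)) (b μ δ τ₁ τ₂ : ℝ)
    (σ v : ℕ → ℝ) (m : ℕ → ℕ) : Prop where
  start_nonneg : 0 ≤ σ 0
  psi_zero_pos : 0 < psi y a b 0
  not_stopped : ∀ j, 0 < |psi y a b (σ j)|
  mem_clarke : ∀ j, v j ∈ clarkeDiff (psi y a b) (σ j)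
  line_search : ∀ j, IsLeast {k : ℕ |
    dualFun y a b (σ j + δ ^ k * newtonDir y a b τ₁ τ₂ (σ j) (v j)) ≥
      dualFun y a b (σ j) +
        μ * δ ^ k * psi y a b (σ j) * newtonDir y a b τ₁ τ₂ (σ j) (v j)} (m j)
  update : ∀ j, σ (j + 1) = σ j + δ ^ m j * newtonDir y a b τ₁ τ₂ (σ j) (v j)

theorem unitSimplex_nonempty {n : ℕ} (hn : 0 < n) : (unitSimplex n).Nonempty := by
  refine ⟨EuclideanSpace.single ⟨0, hn⟩ 1, fun i => ?_, ?_⟩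
  · simp only [EuclideanSpace.single_apply]
    split_ifs <;> norm_num
  · simp [EuclideanSpace.single_apply]

theorem unitSimplex_isClosed (n : ℕ) : IsClosed (unitSimplex n) := by
  have h1 : IsClosed {x : EuclideanSpace ℝ (Fin n) | ∀ i, 0 ≤ x i} := by
    simp only [setOf_forall]
    exact isClosed_iInter fun i => isClosed_le continuous_const (by fun_prop)
  have h2 : IsClosed {x : EuclideanSpace ℝ (Fin n) | ∑ i, x i = 1} :=
    isClosed_eq (by fun_prop) continuous_const
  exact h1.inter h2

theorem unitSimplex_convex (n : ℕ) : Convex ℝ (unitSimplex n) := by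
  intro x hx w hw s t hs ht hst
  refine ⟨fun i => ?_, ?_⟩
  · have := mul_nonneg hs (hx.1 i)
    have := mul_nonneg ht (hw.1 i)
    simp only [PiLp.add_apply, PiLp.smul_apply, smul_eq_mul]
    linarith
  · simp only [PiLp.add_apply, PiLp.smul_apply, smul_eq_mul, Finset.sum_add_distrib,
      ← Finset.mul_sum, hx.2, hw.2]
    linarith

theorem simplexProj_spec {n : ℕ} (hn : 0 < n) (z : EuclideanSpace ℝ (Fin n)) :
    IsProjOnto (unitSimplex n) z (simplexProj z) := by
  obtain ⟨x, hx, hd⟩ :=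
    (unitSimplex_isClosed n).exists_infDist_eq_dist (unitSimplex_nonempty hn) z
  refine Classical.epsilon_spec (p := IsProjOnto (unitSimplex n) z) ⟨x, hx, fun w hw => ?_⟩
  have h : ‖x - z‖ ≤ ‖w - z‖ := by
    rw [← dist_eq_norm, ← dist_eq_norm, dist_comm x, dist_comm w, ← hd]
    exact Metric.infDist_le_dist_of_mem hw
  simp only [mem_setOf_eq]
  gcongr

theorem simplexProj_unique {n : ℕ} (z x : EuclideanSpace ℝ (Fin n))
    (h : IsProjOnto (unitSimplex n) z x) : x = simplexProj z := by
  have h' : IsProjOnto (unitSimplex n) z (simplexProj z) :=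
    Classical.epsilon_spec (p := IsProjOnto (unitSimplex n) z) ⟨x, h⟩
  set w := simplexProj z
  have hm : (1 / 2 : ℝ) • x + (1 / 2 : ℝ) • w ∈ unitSimplex n :=
    unitSimplex_convex n h.1 h'.1 (by norm_num) (by norm_num) (by norm_num)
  have e1 := h.2 h'.1
  have e2 := h'.2 h.1
  have e3 := h.2 hm
  simp only [mem_setOf_eq] at e1 e2 e3
  have hp := parallelogram_law_with_norm ℝ (x - z) (w - z)
  have hs : (x - z) + (w - z) = (2 : ℝ) • ((1 / 2 : ℝ) • x + (1 / 2 : ℝ) • w - z) := by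
    module
  rw [hs, norm_smul, sub_sub_sub_cancel_right, Real.norm_of_nonneg (by norm_num)] at hp
  have : ‖x - w‖ = 0 := by nlinarith [norm_nonneg (x - w)]
  exact sub_eq_zero.1 (norm_eq_zero.1 this)

/-!
The dual function `h` is concave with derivative `ψ`, and `ψ` is piecewise affine because the
projection onto the simplex is affine on each of finitely many polyhedra. Being bounded above on
`[0, ∞)` with positive initial slope, `h` attains its maximum. Since `ψ` is Lipschitz, the line
search cannot shorten the steps indefinitely, so every iteration increases `h` by at least a
constant times `ψ(σʲ)²`; hence `ψ(σʲ) → 0`, and accumulation points are zeros of `ψ`, that is,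
maximizers.

Near such a zero `s`, `ψ` is linear on either side, so at an iterate `x ≠ s` the generalized
differential is a single slope `p` and the unregularized Newton step would hit `s` exactly. The
regularization `ε = O(|ψ x|)` leaves the error `ε / (ε - p) * (x - s)`, which is quadratic in
`x - s`.
-/

section PiecewiseAffine

/-- A map that is affine on each of finitely many convex sets covering the space. The pieces may
overlap and need not be closed, so continuity is not implied. -/
def IsPiecewiseAffine {E F : Type*} [AddCommGroup E] [Module ℝ E] [AddCommGroup F] [Module ℝ F]
    (f : E → F) : Prop :=
  ∃ (ι : Type) (_ : Finite ι) (R : ι → Set E) (A : ι → E →ᵃ[ℝ] F),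
    (∀ i, Convex ℝ (R i)) ∧ (∀ x, ∃ i, x ∈ R i) ∧ ∀ i, EqOn f (A i) (R i)

namespace IsPiecewiseAffine

section Comp

variable {E F G : Type*} [AddCommGroup E] [Module ℝ E] [AddCommGroup F] [Module ℝ F]
  [AddCommGroup G] [Module ℝ G] {f : E → F}

theorem comp_affineMap (hf : IsPiecewiseAffine f) (g : G →ᵃ[ℝ] E) :
    IsPiecewiseAffine (f ∘ g) := by
  obtain ⟨ι, hι, R, A, hconv, hcover, hA⟩ := hf
  exact ⟨ι, hι, fun i => g ⁻¹' R i, fun i => (A i).comp g, fun i => (hconv i).affine_preimage g,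
    fun x => hcover (g x), fun i x hx => hA i hx⟩

theorem affineMap_comp (hf : IsPiecewiseAffine f) (g : F →ᵃ[ℝ] G) :
    IsPiecewiseAffine (g ∘ f) := by
  obtain ⟨ι, hι, R, A, hconv, hcover, hA⟩ := hf
  exact ⟨ι, hι, R, fun i => g.comp (A i), hconv, hcover, fun i x hx => congrArg g (hA i hx)⟩

end Comp

end IsPiecewiseAffine

theorem exists_frequently_mem_of_forall_exists_mem {α ι : Type*} [Finite ι] {R : ι → Set α}
    (hR : ∀ x, ∃ i, x ∈ R i) (l : Filter α) [l.NeBot] : ∃ i, ∃ᶠ x in l, x ∈ R i := by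
  by_contra! h
  obtain ⟨x, hx⟩ := (eventually_all.2 h).exists
  obtain ⟨i, hi⟩ := hR x
  exact hx i hi

theorem eventually_atTop_mem_of_frequently {α : Type*} [Preorder α] [IsDirectedOrder α]
    [Nonempty α] {R : Set α} (hR : R.OrdConnected)
    (h : ∃ᶠ x in atTop, x ∈ R) : ∀ᶠ x in atTop, x ∈ R := by
  obtain ⟨x, hx⟩ := h.exists
  filter_upwards [eventually_ge_atTop x] with w hw
  obtain ⟨z, hz, hzR⟩ := frequently_atTop.1 h w
  exact hR.out hx hzR ⟨hw, hz⟩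

theorem eventually_nhdsGT_mem_of_frequently {α : Type*} [LinearOrder α] [TopologicalSpace α]
    [OrderClosedTopology α] {R : Set α} (hR : R.OrdConnected) {s : α}
    (h : ∃ᶠ x in 𝓝[>] s, x ∈ R) : ∀ᶠ x in 𝓝[>] s, x ∈ R := by
  obtain ⟨z, hzR, hz⟩ := (h.and_eventually self_mem_nhdsWithin).exists
  filter_upwards [Ioc_mem_nhdsGT hz] with w hw
  obtain ⟨x, hxR, hx⟩ := (h.and_eventually (Ioo_mem_nhdsGT hw.1)).exists
  exact hR.out hxR hzR ⟨hx.2.le, hw.2⟩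

theorem affineMap_eq_add_sub_smul {F : Type*} [AddCommGroup F] [Module ℝ F] (A : ℝ →ᵃ[ℝ] F)
    (s x : ℝ) : A x = A s + (x - s) • A.linear 1 := by
  rw [← map_smul, smul_eq_mul, mul_one, ← vsub_eq_sub x s, A.linearMap_vsub, vsub_eq_sub,
    add_sub_cancel]

namespace IsPiecewiseAffine

theorem eventually_atTop_eq_affineMap {F : Type*} [AddCommGroup F] [Module ℝ F]
    {f : ℝ → F} (hf : IsPiecewiseAffine f) :
    ∃ A : ℝ →ᵃ[ℝ] F, f =ᶠ[atTop] A := by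
  obtain ⟨ι, _, R, A, hconv, hcover, hA⟩ := hf
  obtain ⟨i, hi⟩ := exists_frequently_mem_of_forall_exists_mem hcover atTop
  exact ⟨A i, (eventually_atTop_mem_of_frequently (hconv i).ordConnected hi).mono (hA i)⟩

variable {F : Type*} [NormedAddCommGroup F] [NormedSpace ℝ F] {f : ℝ → F}

theorem exists_finite_rightSlopes (hf : IsPiecewiseAffine f) (hc : Continuous f) :
    ∃ P : Set F, P.Finite ∧ ∀ s, ∃ p ∈ P, ∀ᶠ x in 𝓝[>] s, f x = f s + (x - s) • p := by
  obtain ⟨ι, _, R, A, hconv, hcover, hA⟩ := hf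
  refine ⟨range fun i => (A i).linear 1, finite_range _, fun s => ?_⟩
  obtain ⟨i, hi⟩ := exists_frequently_mem_of_forall_exists_mem hcover (𝓝[>] s)
  have hfA : f =ᶠ[𝓝[>] s] A i :=
    (eventually_nhdsGT_mem_of_frequently (hconv i).ordConnected hi).mono (hA i)
  have hs : f s = A i s :=
    tendsto_nhds_unique (hc.continuousAt.mono_left nhdsWithin_le_nhds)
      (((A i).continuous_of_finiteDimensional.continuousAt.mono_left
        nhdsWithin_le_nhds).congr' hfA.symm)
  refine ⟨_, mem_range_self i, hfA.mono fun x hx => ?_⟩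
  rw [hx, hs, affineMap_eq_add_sub_smul (A i) s x]

theorem exists_lipschitzWith (hf : IsPiecewiseAffine f) (hc : Continuous f) :
    ∃ K, LipschitzWith K f := by
  obtain ⟨P, hP, hslope⟩ := hf.exists_finite_rightSlopes hc
  choose f' hf'P hf' using hslope
  obtain ⟨K, hK⟩ : BddAbove (nnnorm '' P) := (hP.image _).bddAbove
  have hderiv (s : ℝ) : HasDerivWithinAt f (f' s) (Ici s) s := by
    have hlin : HasDerivWithinAt (fun x => f s + (x - s) • f' s) (f' s) (Ioi s) s := by
      simpa using (((hasDerivAt_id s).sub_const s).smul_const (f' s)).const_add (f s)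
        |>.hasDerivWithinAt (s := Ioi s)
    exact hasDerivWithinAt_Ioi_iff_Ici.1 (hlin.congr_of_eventuallyEq (hf' s) (by simp))
  have hle {s x : ℝ} (hsx : s ≤ x) : dist (f x) (f s) ≤ K * dist x s := by
    rw [dist_eq_norm, Real.dist_eq, abs_of_nonneg (sub_nonneg.2 hsx)]
    exact norm_image_sub_le_of_norm_deriv_right_le_segment hc.continuousOn
      (fun w _ => hderiv w) (fun w _ => hK (mem_image_of_mem _ (hf'P w))) x ⟨hsx, le_rfl⟩
  refine ⟨K, LipschitzWith.of_dist_le_mul fun x s => ?_⟩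
  rcases le_total s x with h | h
  · exact hle h
  · simpa only [dist_comm] using hle h

/-- Linearity holds on the whole segment from `s` to `x`, not just near `x`: that is what makes the
full Newton step from `x` stay on one piece. -/
theorem eventually_nhdsGT_linear_of_eq_zero (hf : IsPiecewiseAffine f) (hc : Continuous f) {s : ℝ}
    (hs : f s = 0) : ∀ᶠ x in 𝓝[>] s,
      ∃ p, EqOn f (fun w => (w - s) • p) (uIcc x s) ∧ f =ᶠ[𝓝 x] fun w => (w - s) • p := by
  obtain ⟨P, -, hslope⟩ := hf.exists_finite_rightSlopes hc
  obtain ⟨p, -, hp⟩ := hslope s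
  obtain ⟨r, hsr, hr⟩ := mem_nhdsGT_iff_exists_Ioo_subset.1 hp
  have hlin : EqOn f (fun w => (w - s) • p) (Ico s r) := fun w hw => by
    rcases hw.1.eq_or_lt with rfl | hlt
    · simp [hs]
    · simpa [hs] using hr ⟨hlt, hw.2⟩
  filter_upwards [Ioo_mem_nhdsGT hsr] with x hx
  rw [uIcc_of_ge hx.1.le]
  exact ⟨p, hlin.mono (Icc_subset_Ico_right hx.2),
    hlin.eventuallyEq_of_mem (Ico_mem_nhds hx.1 hx.2)⟩

theorem eventually_nhdsNE_linear_of_eq_zero (hf : IsPiecewiseAffine f) (hc : Continuous f) {s : ℝ}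
    (hs : f s = 0) : ∀ᶠ x in 𝓝[≠] s,
      ∃ p, EqOn f (fun w => (w - s) • p) (uIcc x s) ∧ f =ᶠ[𝓝 x] fun w => (w - s) • p := by
  rw [← nhdsLT_sup_nhdsGT, eventually_sup]
  refine ⟨?_, hf.eventually_nhdsGT_linear_of_eq_zero hc hs⟩
  have hneg := (hf.comp_affineMap (-AffineMap.id ℝ ℝ)).eventually_nhdsGT_linear_of_eq_zero
    (s := -s) (hc.comp continuous_neg) (by simpa using hs)
  have hmap : Tendsto Neg.neg (𝓝[<] s) (𝓝[>] (-s)) := tendsto_neg_nhdsLT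
  filter_upwards [hmap.eventually hneg] with x ⟨p, hlin, hnear⟩
  have hflip (w : ℝ) (hw : f (- -w) = (-w - -s) • p) : f w = (w - s) • -p := by
    rw [neg_neg] at hw
    rw [hw, smul_neg, ← neg_smul]
    congr 1
    ring
  refine ⟨-p, fun w hw => hflip w (hlin ?_), ?_⟩
  · change -w ∈ uIcc (-x) (-s)
    simpa only [mem_uIcc, neg_le_neg_iff, and_comm, or_comm] using hw
  · filter_upwards [continuous_neg.continuousAt.eventually hnear] with w hw using hflip w hw

end IsPiecewiseAffine

end PiecewiseAffine

section Supergradient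

/-- `f s` is a supergradient of `h` at every `s`. For continuous `f` this says that `h` is a concave
function with derivative `f`. -/
def IsSupergradientField (h f : ℝ → ℝ) : Prop :=
  ∀ s t, h t ≤ h s + f s * (t - s)

namespace IsSupergradientField

variable {h f : ℝ → ℝ}

theorem antitone (hsup : IsSupergradientField h f) : Antitone f := fun s t hst => by
  rcases hst.eq_or_lt with rfl | hlt
  · exact le_rfl
  · exact le_of_mul_le_mul_right (by linarith [hsup s t, hsup t s]) (sub_pos.2 hlt)

theorem le_of_eq_zero (hsup : IsSupergradientField h f) {s : ℝ} (hs : f s = 0) (x : ℝ) :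
    h x ≤ h s := by
  simpa [hs] using hsup s x

theorem comp_neg (hsup : IsSupergradientField h f) :
    IsSupergradientField (fun x => h (-x)) fun x => -f (-x) := fun s t => by
  linear_combination hsup (-s) (-t)

theorem hasDerivAt (hsup : IsSupergradientField h f) {x : ℝ} (hf : ContinuousAt f x) :
    HasDerivAt h (f x) x := by
  have herror (w : ℝ) : |h w - h x - (w - x) * f x| ≤ |f w - f x| * |w - x| := by
    have hupper : h w - h x - (w - x) * f x ≤ 0 := by linarith [hsup x w]
    rw [← abs_mul, abs_of_nonpos hupper]
    exact le_trans (by linarith [hsup w x]) (neg_le_abs _)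
  rw [hasDerivAt_iff_isLittleO, isLittleO_iff]
  intro c hc
  filter_upwards [Metric.tendsto_nhds.1 hf c hc] with w hw
  exact (herror w).trans (mul_le_mul_of_nonneg_right hw.le (abs_nonneg _))

theorem add_mul_sub_mul_sq_le {K : NNReal} (hsup : IsSupergradientField h f)
    (hK : LipschitzWith K f) (x d : ℝ) : h x + f x * d - K * d ^ 2 ≤ h (x + d) := by
  have hslope : |f (x + d) - f x| ≤ K * |d| := by
    simpa [Real.dist_eq] using hK.dist_le_mul (x + d) x
  have hmul : |(f (x + d) - f x) * d| ≤ K * d ^ 2 := by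
    rw [abs_mul, ← sq_abs d, sq, ← mul_assoc]
    exact mul_le_mul_of_nonneg_right hslope (abs_nonneg d)
  linarith [hsup (x + d) x, neg_le_of_abs_le hmul]

theorem bddAbove_superlevel (hsup : IsSupergradientField h f) {s : ℝ} (hs : f s = 0) (c : ℝ) :
    BddAbove {x | c ≤ h x ∧ f x ≠ 0} := by
  by_cases hright : ∃ x₀ > s, f x₀ ≠ 0
  · obtain ⟨x₀, hx₀, hne⟩ := hright
    have hneg : f x₀ < 0 := lt_of_le_of_ne (hs ▸ hsup.antitone hx₀.le) hne
    refine ⟨x₀ + (c - h x₀) / f x₀, fun x hx => ?_⟩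
    rw [← sub_le_iff_le_add', le_div_iff_of_neg hneg]
    linarith [hsup x₀ x, hx.1]
  · push Not at hright
    exact ⟨s, fun x hx => not_lt.1 fun hsx => hx.2 (hright x hsx)⟩

theorem isBounded_superlevel (hsup : IsSupergradientField h f) {s : ℝ} (hs : f s = 0) (c : ℝ) :
    Bornology.IsBounded {x | c ≤ h x ∧ f x ≠ 0} := by
  refine isBounded_iff_bddBelow_bddAbove.2 ⟨?_, hsup.bddAbove_superlevel hs c⟩
  rw [← bddAbove_neg]
  simpa [Set.neg_ofPred] using hsup.comp_neg.bddAbove_superlevel (s := -s) (by simpa using hs) c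

theorem exists_eq_zero (hsup : IsSupergradientField h f) (hf : Continuous f)
    (hpa : IsPiecewiseAffine f) {s₀ : ℝ} (hbdd : BddAbove (h '' Ici s₀)) (hs₀ : 0 < f s₀) :
    ∃ s, f s = 0 := by
  by_contra! hne
  have hpos (x : ℝ) : 0 < f x := by
    by_contra! hx
    obtain ⟨s, hs⟩ := mem_range_of_exists_le_of_exists_ge hf ⟨x, hx⟩ ⟨s₀, hs₀.le⟩
    exact hne s hs
  obtain ⟨A, hA⟩ := hpa.eventually_atTop_eq_affineMap
  obtain ⟨T, hT⟩ := eventually_atTop.1 hA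
  have hslope : 0 ≤ A.linear 1 := by
    by_contra! hneg
    have htend : Tendsto A atTop atBot := by
      rw [funext (affineMap_eq_add_sub_smul A 0)]
      simpa using tendsto_atBot_add_const_left _ _ (tendsto_id.atTop_mul_const_of_neg hneg)
    obtain ⟨x, hx, hTx⟩ := ((htend.eventually_lt_atBot 0).and (eventually_ge_atTop T)).exists
    exact (hT x hTx ▸ hpos x).not_gt hx
  have hle (x : ℝ) (hx : T ≤ x) : f T ≤ f x := by
    rw [hT x hx, hT T le_rfl, affineMap_eq_add_sub_smul A T x]
    exact le_add_of_nonneg_right (mul_nonneg (sub_nonneg.2 hx) hslope)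
  have hgrowth : Tendsto (fun x => h T + f T * (x - T)) atTop atTop :=
    tendsto_atTop_add_const_left _ _
      ((tendsto_atTop_add_const_right _ (-T) tendsto_id).const_mul_atTop (hpos T))
  obtain ⟨M, hM⟩ := hbdd
  obtain ⟨x, ⟨hx, hTx⟩, hx₀⟩ := (((hgrowth.eventually_gt_atTop M).and
    (eventually_ge_atTop T)).and (eventually_ge_atTop s₀)).exists
  have hxM : h x ≤ M := hM (mem_image_of_mem h hx₀)
  have hxT := mul_le_mul_of_nonneg_right (hle x hTx) (sub_nonneg.2 hTx)
  linarith [hsup x T]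

theorem eq_add_sq_of_eqOn_uIcc (hsup : IsSupergradientField h f) (hf : Continuous f) {s p x : ℝ}
    (hlin : EqOn f (fun w => (w - s) • p) (uIcc x s)) : h x = h s + p / 2 * (x - s) ^ 2 := by
  have hFTC : ∫ w in s..x, f w = h x - h s :=
    intervalIntegral.integral_eq_sub_of_hasDerivAt (fun _ _ => hsup.hasDerivAt hf.continuousAt)
      (hf.intervalIntegrable _ _)
  rw [uIcc_comm] at hlin
  rw [intervalIntegral.integral_congr hlin, intervalIntegral.integral_smul_const,
    intervalIntegral.integral_comp_sub_right (fun w => w) s, integral_id, smul_eq_mul] at hFTC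
  linear_combination -hFTC

end IsSupergradientField

end Supergradient

section Clarke

theorem clarkeDiff_subset {f : ℝ → ℝ} {s : ℝ} {S : Set ℝ} (hconv : Convex ℝ S)
    (hclosed : IsClosed S) (hderiv : ∀ᶠ w in 𝓝 s, deriv f w ∈ S) : clarkeDiff f s ⊆ S :=
  convexHull_min (fun _ ⟨_, hu, _, hv⟩ => hclosed.mem_of_tendsto hv (hu.eventually hderiv)) hconv

theorem clarkeDiff_subset_Icc_of_antitone_of_lipschitzWith {f : ℝ → ℝ} {K : NNReal}
    (hanti : Antitone f) (hK : LipschitzWith K f) (s : ℝ) :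
    clarkeDiff f s ⊆ Icc (-(K : ℝ)) 0 :=
  clarkeDiff_subset (convex_Icc _ _) isClosed_Icc <| .of_forall fun _ =>
    ⟨neg_le_of_abs_le (norm_deriv_le_of_lipschitz hK), hanti.deriv_nonpos⟩

theorem clarkeDiff_subset_singleton_of_eventuallyEq {f : ℝ → ℝ} {x c p : ℝ}
    (hlin : f =ᶠ[𝓝 x] fun w => (w - c) • p) : clarkeDiff f x ⊆ {p} := by
  refine clarkeDiff_subset (convex_singleton p) isClosed_singleton ?_
  filter_upwards [hlin.eventuallyEq_nhds] with w hw
  rw [mem_singleton_iff, hw.deriv_eq]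
  simp

end Clarke

section Convergence

theorem tendsto_of_mapClusterPt_of_contraction {X : Type*} [PseudoMetricSpace X] {σ : ℕ → X}
    {s : X} {U : Set X} {q : ℝ} (hs : MapClusterPt s atTop σ) (hU : U ∈ 𝓝 s) (hq₀ : 0 ≤ q)
    (hq₁ : q < 1) (hstep : ∀ j, σ j ∈ U → dist (σ (j + 1)) s ≤ q * dist (σ j) s) :
    Tendsto σ atTop (𝓝 s) := by
  obtain ⟨r, hr, hrU⟩ := Metric.mem_nhds_iff.1 hU
  obtain ⟨N, hN⟩ := (hs.frequently (Metric.ball_mem_nhds s hr)).exists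
  have hgeom (k : ℕ) : σ (k + N) ∈ Metric.ball s r ∧
      dist (σ (k + N)) s ≤ q ^ k * dist (σ N) s := by
    induction k with
    | zero => simpa using hN
    | succ k ih =>
      have hnext : dist (σ (k + 1 + N)) s ≤ q * dist (σ (k + N)) s := by
        simpa only [add_right_comm] using hstep (k + N) (hrU ih.1)
      refine ⟨(hnext.trans (mul_le_of_le_one_left dist_nonneg hq₁.le)).trans_lt ih.1, ?_⟩
      rw [pow_succ', mul_assoc]
      exact hnext.trans (mul_le_mul_of_nonneg_left ih.2 hq₀)
  refine (tendsto_add_atTop_iff_nat N).1 (tendsto_iff_dist_tendsto_zero.2 ?_)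
  refine squeeze_zero (fun _ => dist_nonneg) (fun k => (hgeom k).2) ?_
  simpa using (tendsto_pow_atTop_nhds_zero_of_lt_one hq₀ hq₁).mul_const (dist (σ N) s)

theorem tendsto_of_mapClusterPt_of_dist_le_mul_sq {X : Type*} [PseudoMetricSpace X] {σ : ℕ → X}
    {s : X} {U : Set X} {C : ℝ} (hs : MapClusterPt s atTop σ) (hU : U ∈ 𝓝 s)
    (hstep : ∀ j, σ j ∈ U → dist (σ (j + 1)) s ≤ C * dist (σ j) s ^ 2) :
    Tendsto σ atTop (𝓝 s) := by
  have hdist : Tendsto (fun x => C * dist x s) (𝓝 s) (𝓝 0) :=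
    Continuous.tendsto' (by fun_prop) _ _ (by simp)
  have hsmall : ∀ᶠ x in 𝓝 s, C * dist x s < 1 / 2 := hdist.eventually_lt_const (by norm_num)
  refine tendsto_of_mapClusterPt_of_contraction (q := 1 / 2) hs (inter_mem hU hsmall)
    (by norm_num) (by norm_num) fun j ⟨hjU, hj⟩ => ?_
  calc dist (σ (j + 1)) s ≤ C * dist (σ j) s * dist (σ j) s := by
        rw [mul_assoc, ← sq]; exact hstep j hjU
    _ ≤ 1 / 2 * dist (σ j) s := mul_le_mul_of_nonneg_right (le_of_lt hj) dist_nonneg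

theorem tendsto_zero_of_add_mul_sq_le {u g : ℕ → ℝ} {c : ℝ} (hc : 0 < c)
    (hu : BddAbove (range u)) (hstep : ∀ j, u j + c * g j ^ 2 ≤ u (j + 1)) :
    Tendsto g atTop (𝓝 0) := by
  have hmono : Monotone u := monotone_nat_of_le_succ fun j =>
    (le_add_of_nonneg_right (mul_nonneg hc.le (sq_nonneg _))).trans (hstep j)
  have hlim := tendsto_atTop_ciSup hmono hu
  have hincr : Tendsto (fun j => (u (j + 1) - u j) / c) atTop (𝓝 0) := by
    simpa using ((hlim.comp (tendsto_add_atTop_nat 1)).sub hlim).div_const c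
  have hsq : Tendsto (fun j => g j ^ 2) atTop (𝓝 0) :=
    squeeze_zero (fun j => sq_nonneg _)
      (fun j => (le_div_iff₀ hc).2 (by linarith [hstep j])) hincr
  rw [tendsto_zero_iff_abs_tendsto_zero]
  simpa [Function.comp_def, Real.sqrt_sq_eq_abs] using hsq.sqrt

end Convergence

section Newton

/-- The Newton direction `-f(x) / (v - ε)` for the equation `f = 0`, with slope `v` and
regularization `ε`. -/
noncomputable def regNewtonDir (f : ℝ → ℝ) (ε x v : ℝ) : ℝ :=
  -f x / (v - ε)

/-- An infinite, never stopping run of the regularized semismooth Newton method for `f = 0`, with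
Armijo line search on the merit function `h`, which is to be maximized. At the iterate `σ j`, `v j`
is the generalized derivative, `ε j` the regularization and `m j` the line search exponent. -/
structure IsNewtonArmijoSeq (h f : ℝ → ℝ) (μ δ C : ℝ) (σ v ε : ℕ → ℝ) (m : ℕ → ℕ) : Prop where
  ne_zero : ∀ j, f (σ j) ≠ 0
  mem_clarkeDiff : ∀ j, v j ∈ clarkeDiff f (σ j)
  reg_mem : ∀ j, ε j ∈ Ioc 0 (C * |f (σ j)|)
  line_search : ∀ j, IsLeast {k : ℕ |
    h (σ j) + μ * δ ^ k * f (σ j) * regNewtonDir f (ε j) (σ j) (v j) ≤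
      h (σ j + δ ^ k * regNewtonDir f (ε j) (σ j) (v j))} (m j)
  update : ∀ j, σ (j + 1) = σ j + δ ^ m j * regNewtonDir f (ε j) (σ j) (v j)

namespace IsSupergradientField

variable {h f : ℝ → ℝ} {K : NNReal} {x d w μ δ : ℝ}

theorem armijo_of_mul_le (hsup : IsSupergradientField h f) (hK : LipschitzWith K f)
    (hd : w * d = f x) {t : ℝ} (ht₀ : 0 ≤ t) (ht : K * t ≤ (1 - μ) * w) :
    h x + μ * t * f x * d ≤ h (x + t * d) := by
  have hquad := hsup.add_mul_sub_mul_sq_le hK x (t * d)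
  have hgain : 0 ≤ t * d ^ 2 * ((1 - μ) * w - K * t) :=
    mul_nonneg (mul_nonneg ht₀ (sq_nonneg d)) (sub_nonneg.2 ht)
  rw [← hd] at hquad ⊢
  linarith

theorem mul_le_armijo_step (hsup : IsSupergradientField h f) (hK : LipschitzWith K f)
    (hd : w * d = f x) (hw : 0 ≤ w) (hμ : μ ∈ Icc 0 1) (hδ : δ ∈ Ioo 0 1) {m : ℕ}
    (hm : IsLeast {k : ℕ | h x + μ * δ ^ k * f x * d ≤ h (x + δ ^ k * d)} m) :
    δ * (1 - μ) * w ≤ (K + w) * δ ^ m := by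
  rcases m with - | k
  · have hle : δ * (1 - μ) ≤ 1 := mul_le_one₀ hδ.2.le (sub_nonneg.2 hμ.2) (by linarith [hμ.1])
    calc δ * (1 - μ) * w ≤ w := mul_le_of_le_one_left hw hle
      _ ≤ (K + w) * δ ^ 0 := by simp
  · have hfail : (1 - μ) * w < K * δ ^ k := by
      by_contra! hle
      have hk := hm.2 (hsup.armijo_of_mul_le hK hd (pow_nonneg hδ.1.le k) hle)
      lia
    calc δ * (1 - μ) * w = δ * ((1 - μ) * w) := mul_assoc _ _ _
      _ ≤ δ * (K * δ ^ k) := mul_le_mul_of_nonneg_left hfail.le hδ.1.le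
      _ = K * δ ^ (k + 1) := by ring
      _ ≤ (K + w) * δ ^ (k + 1) :=
        mul_le_mul_of_nonneg_right (le_add_of_nonneg_right hw) (pow_nonneg hδ.1.le _)

theorem add_mul_sq_le_of_isLeast_armijo (hsup : IsSupergradientField h f) (hK : LipschitzWith K f)
    (hd : w * d = f x) (hw : 0 < w) (hμ : μ ∈ Icc 0 1) (hδ : δ ∈ Ioo 0 1) {m : ℕ}
    (hm : IsLeast {k : ℕ | h x + μ * δ ^ k * f x * d ≤ h (x + δ ^ k * d)} m) :
    h x + μ * δ * (1 - μ) / (K + w) * f x ^ 2 ≤ h (x + δ ^ m * d) := by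
  have hstep : δ * (1 - μ) / (K + w) ≤ δ ^ m / w := by
    rw [div_le_div_iff₀ (by positivity) hw, mul_comm (δ ^ m)]
    exact hsup.mul_le_armijo_step hK hd hw.le hμ hδ hm
  calc h x + μ * δ * (1 - μ) / (K + w) * f x ^ 2
      = h x + δ * (1 - μ) / (K + w) * (μ * f x ^ 2) := by ring
    _ ≤ h x + δ ^ m / w * (μ * f x ^ 2) := by
        have := mul_nonneg hμ.1 (sq_nonneg (f x))
        gcongr
    _ = h x + μ * δ ^ m * f x * d := by
        rw [← hd]
        field_simp
    _ ≤ h (x + δ ^ m * d) := hm.1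

end IsSupergradientField

section LinearPiece

variable {h f : ℝ → ℝ} {s p ε x : ℝ}

theorem add_regNewtonDir_eq (hx : f x = (x - s) • p) (hpε : p ≠ ε) :
    x + regNewtonDir f ε x p = s + ε / (ε - p) * (x - s) := by
  have hne : ε - p ≠ 0 := sub_ne_zero.2 hpε.symm
  rw [regNewtonDir, hx, smul_eq_mul, ← neg_sub ε p, neg_div_neg_eq]
  field_simp
  ring

/-- On a linear piece `h` is the parabola `h s + p / 2 * (x - s) ^ 2`, and the regularized full step
contracts `x - s` by the factor `θ = ε / (ε - p)`. The Armijo test thus amounts to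
`μ ≤ (1 + θ) / 2`. -/
theorem IsSupergradientField.armijo_regNewtonDir_of_eqOn_uIcc (hsup : IsSupergradientField h f)
    (hf : Continuous f) (hlin : EqOn f (fun w => (w - s) • p) (uIcc x s)) (hp : p ≤ 0)
    (hε : 0 < ε) {μ : ℝ} (hμ : μ ≤ 1 / 2) :
    h x + μ * f x * regNewtonDir f ε x p ≤ h (x + regNewtonDir f ε x p) := by
  have hx : f x = (x - s) • p := hlin left_mem_uIcc
  have hnext := add_regNewtonDir_eq hx (hp.trans_lt hε).ne
  set θ := ε / (ε - p)
  have hθ₀ : 0 ≤ θ := div_nonneg hε.le (by linarith)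
  have hθ₁ : θ ≤ 1 := div_le_one_of_le₀ (by linarith) (by linarith)
  have hdir : regNewtonDir f ε x p = (θ - 1) * (x - s) := by linear_combination hnext
  have hmem : s + θ * (x - s) ∈ uIcc x s := by
    rw [← segment_eq_uIcc, segment_symm, segment_eq_image']
    exact ⟨θ, ⟨hθ₀, hθ₁⟩, rfl⟩
  have hparabola := hsup.eq_add_sq_of_eqOn_uIcc hf hlin
  have hparabola' := hsup.eq_add_sq_of_eqOn_uIcc hf
    (hlin.mono (uIcc_subset_uIcc hmem right_mem_uIcc))
  have hgain : 0 ≤ -p * (x - s) ^ 2 * ((1 - θ) * ((1 + θ) / 2 - μ)) :=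
    mul_nonneg (mul_nonneg (neg_nonneg.2 hp) (sq_nonneg _))
      (mul_nonneg (sub_nonneg.2 hθ₁) (by linarith))
  rw [hnext, hdir, hx, hparabola, hparabola', smul_eq_mul]
  linarith

theorem abs_add_regNewtonDir_sub_le (hx : f x = (x - s) • p) (hp : p < 0) (hε₀ : 0 ≤ ε) {C : ℝ}
    (hε : ε ≤ C * |f x|) : |x + regNewtonDir f ε x p - s| ≤ C * |x - s| ^ 2 := by
  have hfactor : |ε / (ε - p)| ≤ ε / |p| := by
    rw [abs_of_nonneg (div_nonneg hε₀ (by linarith)), abs_of_neg hp]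
    exact div_le_div_of_nonneg_left hε₀ (neg_pos.2 hp) (by linarith)
  have hp' : 0 < |p| := abs_pos.2 hp.ne
  rw [hx, smul_eq_mul, abs_mul] at hε
  calc |x + regNewtonDir f ε x p - s| = |ε / (ε - p)| * |x - s| := by
        rw [add_regNewtonDir_eq hx (hp.trans_le hε₀).ne, add_sub_cancel_left, abs_mul]
    _ ≤ C * (|x - s| * |p|) / |p| * |x - s| := by gcongr; exact hfactor.trans (by gcongr)
    _ = C * |x - s| ^ 2 := by field_simp

end LinearPiece

namespace IsNewtonArmijoSeq

variable {h f : ℝ → ℝ} {μ δ C : ℝ} {σ v ε : ℕ → ℝ} {m : ℕ → ℕ}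

theorem mem_Icc (hσ : IsNewtonArmijoSeq h f μ δ C σ v ε m) (hsup : IsSupergradientField h f)
    {K : NNReal} (hK : LipschitzWith K f) (j : ℕ) : v j ∈ Icc (-(K : ℝ)) 0 :=
  clarkeDiff_subset_Icc_of_antitone_of_lipschitzWith hsup.antitone hK _ (hσ.mem_clarkeDiff j)

theorem reg_sub_pos (hσ : IsNewtonArmijoSeq h f μ δ C σ v ε m) (hsup : IsSupergradientField h f)
    {K : NNReal} (hK : LipschitzWith K f) (j : ℕ) : 0 < ε j - v j := by
  linarith [(hσ.mem_Icc hsup hK j).2, (hσ.reg_mem j).1]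

theorem add_mul_sq_le (hσ : IsNewtonArmijoSeq h f μ δ C σ v ε m)
    (hsup : IsSupergradientField h f) {K : NNReal} (hK : LipschitzWith K f) (hμ : μ ∈ Icc 0 1)
    (hδ : δ ∈ Ioo 0 1) (j : ℕ) :
    h (σ j) + μ * δ * (1 - μ) / (K + (ε j - v j)) * f (σ j) ^ 2 ≤ h (σ (j + 1)) := by
  have hw := hσ.reg_sub_pos hsup hK j
  have hd : (ε j - v j) * regNewtonDir f (ε j) (σ j) (v j) = f (σ j) := by
    rw [regNewtonDir, ← neg_sub (ε j), neg_div_neg_eq, mul_div_cancel₀ _ hw.ne']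
  rw [hσ.update]
  exact hsup.add_mul_sq_le_of_isLeast_armijo hK hd hw hμ hδ (hσ.line_search j)

theorem monotone_merit (hσ : IsNewtonArmijoSeq h f μ δ C σ v ε m)
    (hsup : IsSupergradientField h f) {K : NNReal} (hK : LipschitzWith K f) (hμ : μ ∈ Icc 0 1)
    (hδ : δ ∈ Ioo 0 1) : Monotone (h ∘ σ) := monotone_nat_of_le_succ fun j => by
  have hw := hσ.reg_sub_pos hsup hK j
  have hnum : 0 ≤ μ * δ * (1 - μ) :=
    mul_nonneg (mul_nonneg hμ.1 hδ.1.le) (sub_nonneg.2 hμ.2)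
  exact (le_add_of_nonneg_right (by positivity)).trans (hσ.add_mul_sq_le hsup hK hμ hδ j)

theorem isBounded_range (hσ : IsNewtonArmijoSeq h f μ δ C σ v ε m)
    (hsup : IsSupergradientField h f) {K : NNReal} (hK : LipschitzWith K f) (hμ : μ ∈ Icc 0 1)
    (hδ : δ ∈ Ioo 0 1) {s : ℝ} (hs : f s = 0) : Bornology.IsBounded (range σ) :=
  (hsup.isBounded_superlevel hs (h (σ 0))).subset <| range_subset_iff.2 fun j =>
    ⟨hσ.monotone_merit hsup hK hμ hδ j.zero_le, hσ.ne_zero j⟩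

theorem tendsto_zero (hσ : IsNewtonArmijoSeq h f μ δ C σ v ε m)
    (hsup : IsSupergradientField h f) {K : NNReal} (hK : LipschitzWith K f) (hμ : μ ∈ Ioo 0 1)
    (hδ : δ ∈ Ioo 0 1) {s : ℝ} (hs : f s = 0) : Tendsto (f ∘ σ) atTop (𝓝 0) := by
  have hμ' := Ioo_subset_Icc_self hμ
  obtain ⟨M, hM⟩ :=
    isBounded_iff_forall_norm_le.1 (hK.isBounded_image (hσ.isBounded_range hsup hK hμ' hδ hs))
  have hfM (j : ℕ) : |f (σ j)| ≤ M := hM _ (mem_image_of_mem f (mem_range_self j))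
  have hC : 0 < C :=
    pos_of_mul_pos_left ((hσ.reg_mem 0).1.trans_le (hσ.reg_mem 0).2) (abs_nonneg _)
  have hnum : 0 < μ * δ * (1 - μ) := mul_pos (mul_pos hμ.1 hδ.1) (sub_pos.2 hμ.2)
  have hM₀ : 0 < M := (abs_pos.2 (hσ.ne_zero 0)).trans_le (hfM 0)
  have hmax : BddAbove (range (h ∘ σ)) :=
    ⟨h s, forall_mem_range.2 fun _ => hsup.le_of_eq_zero hs _⟩
  refine tendsto_zero_of_add_mul_sq_le (c := μ * δ * (1 - μ) / (K + (C * M + K))) (by positivity)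
    hmax fun j => le_trans ?_ (hσ.add_mul_sq_le hsup hK hμ' hδ j)
  have hε : ε j ≤ C * M := (hσ.reg_mem j).2.trans (mul_le_mul_of_nonneg_left (hfM j) hC.le)
  have hw := hσ.reg_sub_pos hsup hK j
  have hwM : ε j - v j ≤ C * M + K := by linarith [(hσ.mem_Icc hsup hK j).1]
  simp only [Function.comp_apply]
  gcongr

theorem exponent_eq_zero (hσ : IsNewtonArmijoSeq h f μ δ C σ v ε m) {j : ℕ}
    (hfull : h (σ j) + μ * f (σ j) * regNewtonDir f (ε j) (σ j) (v j)
      ≤ h (σ j + regNewtonDir f (ε j) (σ j) (v j))) : m j = 0 :=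
  Nat.le_zero.1 <| (hσ.line_search j).2 <| by simpa using hfull

theorem exists_mem_nhds_quadratic (hσ : IsNewtonArmijoSeq h f μ δ C σ v ε m)
    (hsup : IsSupergradientField h f) (hf : Continuous f) (hpa : IsPiecewiseAffine f)
    (hμ : μ ≤ 1 / 2) {s : ℝ} (hs : f s = 0) :
    ∃ U ∈ 𝓝 s, ∀ j, σ j ∈ U → |σ (j + 1) - s| ≤ C * |σ j - s| ^ 2 := by
  obtain ⟨K, hK⟩ := hpa.exists_lipschitzWith hf
  refine ⟨_, eventually_nhdsWithin_iff.1 (hpa.eventually_nhdsNE_linear_of_eq_zero hf hs),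
    fun j hj => ?_⟩
  have hne : σ j ≠ s := fun heq => hσ.ne_zero j (heq ▸ hs)
  obtain ⟨p, hlin, hnear⟩ := hj hne
  have hv : v j = p := clarkeDiff_subset_singleton_of_eventuallyEq hnear (hσ.mem_clarkeDiff j)
  subst hv
  have hx : f (σ j) = (σ j - s) • v j := hlin left_mem_uIcc
  have hv₀ : v j ≤ 0 := (hσ.mem_Icc hsup hK j).2
  have hv' : v j < 0 := hv₀.lt_of_ne fun hv => hσ.ne_zero j (by rw [hx, hv, smul_zero])
  have hε := hσ.reg_mem j
  rw [hσ.update, hσ.exponent_eq_zero (hsup.armijo_regNewtonDir_of_eqOn_uIcc hf hlin hv₀ hε.1 hμ),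
    pow_zero, one_mul]
  exact abs_add_regNewtonDir_sub_le hx hv' hε.1.le hε.2

theorem tendsto_and_isBigO_sq (hσ : IsNewtonArmijoSeq h f μ δ C σ v ε m)
    (hsup : IsSupergradientField h f) (hf : Continuous f) (hpa : IsPiecewiseAffine f)
    (hμ : μ ≤ 1 / 2) {s : ℝ} (hs : f s = 0) (hcluster : MapClusterPt s atTop σ) :
    Tendsto σ atTop (𝓝 s) ∧
      (fun j => |σ (j + 1) - s|) =O[atTop] fun j => |σ j - s| ^ 2 := by
  obtain ⟨U, hU, hstep⟩ := hσ.exists_mem_nhds_quadratic hsup hf hpa hμ hs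
  have hlim := tendsto_of_mapClusterPt_of_dist_le_mul_sq hcluster hU hstep
  refine ⟨hlim, IsBigO.of_bound C ?_⟩
  filter_upwards [hlim hU] with j hj
  simpa using hstep j hj

end IsNewtonArmijoSeq

end Newton

theorem mainTheorem2_general {h f : ℝ → ℝ} {μ δ C : ℝ} {σ v ε : ℕ → ℝ} {m : ℕ → ℕ}
    (hsup : IsSupergradientField h f) (hf : Continuous f) (hpa : IsPiecewiseAffine f)
    (hbdd : BddAbove (h '' Ici 0)) (hf₀ : 0 < f 0) (hμ : μ ∈ Ioo 0 (1 / 2)) (hδ : δ ∈ Ioo 0 1)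
    (hσ : IsNewtonArmijoSeq h f μ δ C σ v ε m) :
    Bornology.IsBounded (range σ) ∧
      ∀ s : ℝ, MapClusterPt s atTop σ →
        (s ∈ Ici 0 ∧ IsMaxOn h (Ici 0) s) ∧ Tendsto σ atTop (𝓝 s) ∧
          (fun j => |σ (j + 1) - s|) =O[atTop] fun j => |σ j - s| ^ 2 := by
  have hμ₁ : μ ∈ Ioo 0 1 := ⟨hμ.1, hμ.2.trans one_half_lt_one⟩
  obtain ⟨K, hK⟩ := hpa.exists_lipschitzWith hf
  obtain ⟨r, hr⟩ := hsup.exists_eq_zero hf hpa hbdd hf₀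
  refine ⟨hσ.isBounded_range hsup hK (Ioo_subset_Icc_self hμ₁) hδ hr, fun s hcluster => ?_⟩
  have hs : f s = 0 := eq_of_nhds_neBot <|
    (hcluster.continuousAt_comp hf.continuousAt).clusterPt.mono
      (hσ.tendsto_zero hsup hK hμ₁ hδ hr)
  have hs₀ : 0 ≤ s := (hsup.antitone.reflect_lt (hs ▸ hf₀)).le
  exact ⟨⟨hs₀, fun x _ => hsup.le_of_eq_zero hs x⟩,
    hσ.tendsto_and_isBigO_sq hsup hf hpa hμ.2.le hs hcluster⟩

section Simplex

variable {n : ℕ}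

theorem pos_of_mem_unitSimplex {x : EuclideanSpace ℝ (Fin n)} (hx : x ∈ unitSimplex n) :
    0 < n := by
  refine Nat.pos_of_ne_zero ?_
  rintro rfl
  simpa using hx.2

theorem isProjOnto_iff_inner_le_zero {S : Set (EuclideanSpace ℝ (Fin n))} (hS : Convex ℝ S)
    {z x : EuclideanSpace ℝ (Fin n)} :
    IsProjOnto S z x ↔ x ∈ S ∧ ∀ w ∈ S, inner ℝ (z - x) (w - x) ≤ 0 := by
  refine and_congr_right fun hx => ?_
  have hnonempty : Nonempty S := ⟨x, hx⟩
  have hbdd : BddBelow (range fun w : S => ‖z - w‖) :=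
    ⟨0, forall_mem_range.2 fun _ => norm_nonneg _⟩
  have hsq (w : EuclideanSpace ℝ (Fin n)) :
      1 / 2 * ‖x - z‖ ^ 2 ≤ 1 / 2 * ‖w - z‖ ^ 2 ↔ ‖z - x‖ ≤ ‖z - w‖ := by
    rw [mul_le_mul_iff_right₀ one_half_pos, sq_le_sq₀ (norm_nonneg _) (norm_nonneg _),
      norm_sub_rev x, norm_sub_rev w]
  simp only [← norm_eq_iInf_iff_real_inner_le_zero hS hx, isMinOn_iff, hsq]
  exact ⟨fun h => le_antisymm (le_ciInf fun w => h w w.2) (ciInf_le hbdd ⟨x, hx⟩),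
    fun h w hw => h.trans_le (ciInf_le hbdd ⟨w, hw⟩)⟩

theorem norm_sub_le_of_inner_sub_le_zero {E : Type*} [NormedAddCommGroup E] [InnerProductSpace ℝ E]
    {z z' x x' : E} (h : inner ℝ (z - x) (x' - x) ≤ 0) (h' : inner ℝ (z' - x') (x - x') ≤ 0) :
    ‖x - x'‖ ≤ ‖z - z'‖ := by
  have hsum : inner ℝ (z - x) (x' - x) + inner ℝ (z' - x') (x - x')
      = ‖x - x'‖ ^ 2 - inner ℝ (z - z') (x - x') := by
    rw [← real_inner_self_eq_norm_sq, ← neg_sub x x', inner_neg_right, neg_add_eq_sub,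
      ← inner_sub_left, ← inner_sub_left]
    congr 1
    abel
  have hcauchy := real_inner_le_norm (z - z') (x - x')
  by_contra! hlt
  nlinarith [norm_nonneg (z - z')]

theorem lipschitzWith_simplexProj (hn : 0 < n) :
    LipschitzWith 1 (simplexProj : EuclideanSpace ℝ (Fin n) → EuclideanSpace ℝ (Fin n)) := by
  have hproj (z : EuclideanSpace ℝ (Fin n)) :=
    (isProjOnto_iff_inner_le_zero (unitSimplex_convex n)).1 (simplexProj_spec hn z)
  refine LipschitzWith.of_dist_le_mul fun z z' => ?_
  rw [NNReal.coe_one, one_mul, dist_eq_norm, dist_eq_norm]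
  exact norm_sub_le_of_inner_sub_le_zero ((hproj z).2 _ (hproj z').1) ((hproj z').2 _ (hproj z).1)

theorem exists_sum_max_sub_eq {ι : Type*} [Fintype ι] [Nonempty ι] (z : ι → ℝ) {c : ℝ}
    (hc : 0 ≤ c) : ∃ θ : ℝ, ∑ i, max (z i - θ) 0 = c := by
  obtain ⟨M, hM⟩ := (finite_range z).bddAbove
  obtain ⟨i₀⟩ := ‹Nonempty ι›
  have hlow : ∑ i, max (z i - M) 0 ≤ c := by
    rwa [Finset.sum_eq_zero fun i _ => max_eq_right (sub_nonpos.2 (hM (mem_range_self i)))]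
  have hhigh : c ≤ ∑ i, max (z i - (z i₀ - c)) 0 :=
    calc c ≤ max (z i₀ - (z i₀ - c)) 0 := by simp
      _ ≤ _ := Finset.single_le_sum (f := fun i => max (z i - (z i₀ - c)) 0)
        (fun _ _ => le_max_right _ _) (Finset.mem_univ i₀)
  exact mem_range_of_exists_le_of_exists_ge (by fun_prop) ⟨M, hlow⟩ ⟨z i₀ - c, hhigh⟩

/-- The `i`-th coordinate `zᵢ - (∑_{j ∈ I} zⱼ - 1) / |I|` of `z` after the uniform shift that makes
the coordinates in `I` sum to one. The subtracted term is the multiplier of the constraint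
`∑ xⱼ = 1` in the projection onto the face of the simplex spanned by `I`; the case `I = ∅` is
meaningless. -/
noncomputable def faceResidual (I : Finset (Fin n)) (i : Fin n) :
    EuclideanSpace ℝ (Fin n) →ᵃ[ℝ] ℝ :=
  (EuclideanSpace.proj i : EuclideanSpace ℝ (Fin n) →L[ℝ] ℝ).toLinearMap.toAffineMap -
    (I.card : ℝ)⁻¹ •
      ((∑ j ∈ I, (EuclideanSpace.proj j : EuclideanSpace ℝ (Fin n) →L[ℝ] ℝ).toLinearMap).toAffineMap
        - AffineMap.const ℝ _ 1)

theorem faceResidual_apply (I : Finset (Fin n)) (i : Fin n) (z : EuclideanSpace ℝ (Fin n)) :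
    faceResidual I i z = z i - (I.card : ℝ)⁻¹ * (∑ j ∈ I, z j - 1) := by
  simp [faceResidual]

theorem sum_faceResidual {I : Finset (Fin n)} (hI : I.Nonempty) (z : EuclideanSpace ℝ (Fin n)) :
    ∑ i ∈ I, faceResidual I i z = 1 := by
  have hcard : (I.card : ℝ) ≠ 0 := Nat.cast_ne_zero.2 hI.card_ne_zero
  simp only [faceResidual_apply, Finset.sum_sub_distrib, Finset.sum_const, nsmul_eq_mul]
  field_simp
  ring

/-- The orthogonal projection onto the affine hull of the face of the simplex spanned by `I`. -/
noncomputable def faceProj (I : Finset (Fin n)) :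
    EuclideanSpace ℝ (Fin n) →ᵃ[ℝ] EuclideanSpace ℝ (Fin n) :=
  (WithLp.linearEquiv 2 ℝ (Fin n → ℝ)).symm.toLinearMap.toAffineMap.comp
    (AffineMap.pi fun i => if i ∈ I then faceResidual I i else 0)

theorem faceProj_apply (I : Finset (Fin n)) (z : EuclideanSpace ℝ (Fin n)) (i : Fin n) :
    faceProj I z i = if i ∈ I then faceResidual I i z else 0 := by
  simp only [faceProj]
  split_ifs with hi <;> simp [hi]

/-- The points whose projection onto the affine hull of the face spanned by `I` satisfies the
optimality conditions of the projection onto the whole simplex. -/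
def faceRegion (I : Finset (Fin n)) : Set (EuclideanSpace ℝ (Fin n)) :=
  {z | (∀ i ∈ I, 0 ≤ faceResidual I i z) ∧ ∀ i ∉ I, faceResidual I i z ≤ 0}

theorem convex_faceRegion (I : Finset (Fin n)) : Convex ℝ (faceRegion I) := by
  have hregion : faceRegion I = (⋂ i ∈ I, faceResidual I i ⁻¹' Ici 0) ∩
      ⋂ i ∉ I, faceResidual I i ⁻¹' Iic 0 := by
    ext z
    simp [faceRegion]
  rw [hregion]
  exact (convex_iInter₂ fun i _ => (convex_Ici 0).affine_preimage _).inter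
    (convex_iInter₂ fun i _ => (convex_Iic 0).affine_preimage _)

theorem exists_mem_faceRegion (hn : 0 < n) (z : EuclideanSpace ℝ (Fin n)) :
    ∃ I : Finset (Fin n), I.Nonempty ∧ z ∈ faceRegion I := by
  have : Nonempty (Fin n) := Fin.pos_iff_nonempty.1 hn
  obtain ⟨θ, hθ⟩ := exists_sum_max_sub_eq z zero_le_one
  let I : Finset (Fin n) := {i | 0 ≤ z i - θ}
  have hsum : ∑ i ∈ I, (z i - θ) = 1 := by
    rw [← hθ, Finset.sum_filter]
    refine Finset.sum_congr rfl fun i _ => ?_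
    split_ifs with hi
    · exact (max_eq_left hi).symm
    · exact (max_eq_right (not_le.1 hi).le).symm
  have hI : I.Nonempty := Finset.nonempty_of_sum_ne_zero (hsum.trans_ne one_ne_zero)
  have hcard : (I.card : ℝ) ≠ 0 := Nat.cast_ne_zero.2 hI.card_ne_zero
  have hres (i : Fin n) : faceResidual I i z = z i - θ := by
    rw [Finset.sum_sub_distrib, Finset.sum_const, nsmul_eq_mul] at hsum
    rw [faceResidual_apply, sub_right_inj, inv_mul_eq_iff_eq_mul₀ hcard]
    linarith
  refine ⟨I, hI, fun i hi => ?_, fun i hi => ?_⟩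
  · rw [hres]
    exact Finset.mem_filter_univ i |>.1 hi
  · rw [hres]
    exact (not_le.1 fun h => hi (Finset.mem_filter_univ i |>.2 h)).le

theorem faceProj_mem_unitSimplex {I : Finset (Fin n)} (hI : I.Nonempty)
    {z : EuclideanSpace ℝ (Fin n)} (hz : z ∈ faceRegion I) : faceProj I z ∈ unitSimplex n := by
  refine ⟨fun i => ?_, ?_⟩
  · rw [faceProj_apply]
    split_ifs with hi
    exacts [hz.1 i hi, le_rfl]
  · simp only [faceProj_apply, Finset.sum_ite_mem, Finset.univ_inter, sum_faceResidual hI]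

theorem inner_sub_faceProj_le_zero {I : Finset (Fin n)} (hI : I.Nonempty)
    {z w : EuclideanSpace ℝ (Fin n)} (hz : z ∈ faceRegion I) (hw : w ∈ unitSimplex n) :
    inner ℝ (z - faceProj I z) (w - faceProj I z) ≤ 0 := by
  set x := faceProj I z with hx
  set θ := (I.card : ℝ)⁻¹ * (∑ j ∈ I, z j - 1)
  have hcoord (i : Fin n) : (z i - x i) * (w i - x i) ≤ θ * (w i - x i) := by
    by_cases hi : i ∈ I
    · have hxi : x i = z i - θ := by rw [hx, faceProj_apply, if_pos hi, faceResidual_apply]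
      rw [hxi, sub_sub_cancel]
    · have hxi : x i = 0 := by rw [hx, faceProj_apply, if_neg hi]
      have hzi : z i ≤ θ := sub_nonpos.1 ((faceResidual_apply I i z).symm.trans_le (hz.2 i hi))
      simpa only [hxi, sub_zero] using mul_le_mul_of_nonneg_right hzi (hw.1 i)
  calc inner ℝ (z - x) (w - x) = ∑ i, (z i - x i) * (w i - x i) := by
        simp [PiLp.inner_apply, mul_comm]
    _ ≤ ∑ i, θ * (w i - x i) := Finset.sum_le_sum fun i _ => hcoord i
    _ = 0 := by
        rw [← Finset.mul_sum, Finset.sum_sub_distrib, hw.2, (faceProj_mem_unitSimplex hI hz).2,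
          sub_self, mul_zero]

theorem simplexProj_eq_faceProj {I : Finset (Fin n)} (hI : I.Nonempty)
    {z : EuclideanSpace ℝ (Fin n)} (hz : z ∈ faceRegion I) : simplexProj z = faceProj I z :=
  (simplexProj_unique z _ <| (isProjOnto_iff_inner_le_zero (unitSimplex_convex n)).2
    ⟨faceProj_mem_unitSimplex hI hz, fun _ hw => inner_sub_faceProj_le_zero hI hz hw⟩).symm

theorem isPiecewiseAffine_simplexProj (hn : 0 < n) :
    IsPiecewiseAffine (simplexProj : EuclideanSpace ℝ (Fin n) → EuclideanSpace ℝ (Fin n)) :=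
  ⟨{I : Finset (Fin n) // I.Nonempty}, inferInstance, fun I => faceRegion I.1,
    fun I => faceProj I.1, fun I => convex_faceRegion I.1,
    fun z => let ⟨I, hI, hz⟩ := exists_mem_faceRegion hn z; ⟨⟨I, hI⟩, hz⟩,
    fun I _ hz => simplexProj_eq_faceProj I.2 hz⟩

end Simplex

section Dual

variable {n : ℕ} (y a : EuclideanSpace ℝ (Fin n)) (b : ℝ)

theorem continuous_psi (hn : 0 < n) : Continuous (psi y a b) := by
  have hproj := (lipschitzWith_simplexProj hn).continuous
  unfold psi
  fun_prop

theorem isPiecewiseAffine_psi (hn : 0 < n) : IsPiecewiseAffine (psi y a b) := by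
  let ray : ℝ →ᵃ[ℝ] EuclideanSpace ℝ (Fin n) := AffineMap.lineMap y (y - a)
  let value : EuclideanSpace ℝ (Fin n) →ᵃ[ℝ] ℝ :=
    (innerₛₗ ℝ a).toAffineMap - AffineMap.const ℝ _ b
  have hpsi : psi y a b = value ∘ simplexProj ∘ ray := by
    ext σ
    simp [psi, ray, value, AffineMap.lineMap_apply, sub_eq_neg_add]
  rw [hpsi]
  exact ((isPiecewiseAffine_simplexProj hn).comp_affineMap ray).affineMap_comp value

theorem lagrangian_eq_completed_square (x : EuclideanSpace ℝ (Fin n)) (σ : ℝ) :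
    lagrangian y a b x σ = 1 / 2 * ‖x - (y - σ • a)‖ ^ 2
      + (σ * inner ℝ a y - σ ^ 2 / 2 * ‖a‖ ^ 2 - σ * b) := by
  have hsq := norm_add_sq_real (x - y) (σ • a)
  rw [inner_smul_right, inner_sub_left, norm_smul, mul_pow, Real.norm_eq_abs, sq_abs,
    real_inner_comm, real_inner_comm a y] at hsq
  rw [sub_sub_eq_add_sub, add_sub_right_comm, hsq, lagrangian]
  ring

theorem isLeast_lagrangian_simplexProj (hn : 0 < n) (σ : ℝ) :
    IsLeast ((fun x => lagrangian y a b x σ) '' unitSimplex n)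
      (lagrangian y a b (simplexProj (y - σ • a)) σ) := by
  obtain ⟨hmem, hmin⟩ := simplexProj_spec hn (y - σ • a)
  refine ⟨mem_image_of_mem _ hmem, forall_mem_image.2 fun x hx => ?_⟩
  simp only [lagrangian_eq_completed_square]
  exact add_le_add_left (hmin hx) _

theorem dualFun_eq_lagrangian_simplexProj (hn : 0 < n) (σ : ℝ) :
    dualFun y a b σ = lagrangian y a b (simplexProj (y - σ • a)) σ :=
  (isLeast_lagrangian_simplexProj y a b hn σ).csInf_eq

theorem dualFun_le_lagrangian (hn : 0 < n) {x : EuclideanSpace ℝ (Fin n)} (hx : x ∈ unitSimplex n)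
    (σ : ℝ) : dualFun y a b σ ≤ lagrangian y a b x σ :=
  csInf_le (isLeast_lagrangian_simplexProj y a b hn σ).bddBelow (mem_image_of_mem _ hx)

theorem isSupergradientField_dualFun (hn : 0 < n) :
    IsSupergradientField (dualFun y a b) (psi y a b) := fun s t => by
  have hmem : simplexProj (y - s • a) ∈ unitSimplex n := (simplexProj_spec hn _).1
  refine (dualFun_le_lagrangian y a b hn hmem t).trans_eq ?_
  rw [dualFun_eq_lagrangian_simplexProj y a b hn, lagrangian, lagrangian, psi]
  ring

theorem bddAbove_dualFun_image_Ici {x : EuclideanSpace ℝ (Fin n)} (hx : x ∈ feasibleSet a b) :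
    BddAbove (dualFun y a b '' Ici 0) := by
  refine ⟨1 / 2 * ‖x - y‖ ^ 2, forall_mem_image.2 fun σ hσ => ?_⟩
  calc dualFun y a b σ ≤ lagrangian y a b x σ :=
        dualFun_le_lagrangian y a b (pos_of_mem_unitSimplex hx.2) hx.2 σ
    _ ≤ 1 / 2 * ‖x - y‖ ^ 2 :=
        add_le_of_nonpos_right (mul_nonpos_of_nonneg_of_nonpos hσ (sub_nonpos.2 hx.1))

variable {y a b}

theorem IsSSNSequence.isNewtonArmijoSeq {μ δ τ₁ τ₂ : ℝ} {σ v : ℕ → ℝ} {m : ℕ → ℕ}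
    (hσ : IsSSNSequence y a b μ δ τ₁ τ₂ σ v m) (hτ₁ : 0 < τ₁) (hτ₂ : 0 < τ₂) :
    IsNewtonArmijoSeq (dualFun y a b) (psi y a b) μ δ τ₂ σ v
      (fun j => τ₂ * min τ₁ |psi y a b (σ j)|) m where
  ne_zero j := abs_pos.1 (hσ.not_stopped j)
  mem_clarkeDiff := hσ.mem_clarke
  reg_mem j := ⟨mul_pos hτ₂ (lt_min hτ₁ (hσ.not_stopped j)),
    mul_le_mul_of_nonneg_left (min_le_right _ _) hτ₂.le⟩
  line_search := hσ.line_search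
  update := hσ.update

end Dual

theorem mainTheorem2 {n : ℕ} (y a : EuclideanSpace ℝ (Fin n)) (b : ℝ)
    (hfeas : (feasibleSet a b).Nonempty)
    (hab : a ≠ WithLp.toLp 2 (fun _ => b))
    (μ δ τ₁ τ₂ : ℝ) (hμ : μ ∈ Ioo (0 : ℝ) (1 / 2)) (hδ : δ ∈ Ioo (0 : ℝ) 1)
    (hτ₁ : τ₁ ∈ Ioo (0 : ℝ) 1) (hτ₂ : τ₂ ∈ Ioc (0 : ℝ) 1)
    (σ v : ℕ → ℝ) (m : ℕ → ℕ) (hσ : IsSSNSequence y a b μ δ τ₁ τ₂ σ v m) :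
    Bornology.IsBounded (range σ) ∧
      ∀ s : ℝ, MapClusterPt s atTop σ →
        IsDualSolution y a b s ∧ Tendsto σ atTop (𝓝 s) ∧
          (fun j => |σ (j + 1) - s|) =O[atTop] (fun j => |σ j - s| ^ 2) := by
  obtain ⟨x, hx⟩ := hfeas
  have hn := pos_of_mem_unitSimplex hx.2
  exact mainTheorem2_general (isSupergradientField_dualFun y a b hn) (continuous_psi y a b hn)
    (isPiecewiseAffine_psi y a b hn) (bddAbove_dualFun_image_Ici y a b hx) hσ.psi_zero_pos hμ hδ
    (hσ.isNewtonArmijoSeq hτ₁.1 hτ₂.1)
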